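/- Let $(q_j)_{j\ge 1}$ be real numbers in $(0,1)$ and let $W=(w_{ij})_{i,j\ge 1}$ be an array of independent random variables such that $\mathrm{Prob}(w_{ij}=k)=(1-q_j)\,q_j^{k}$ for all $i,j\ge 1$ and $k\in\mathbb{N}=\{0,1,2,\dots\}$. For $m,n\ge 1$ let $$G(m,n)=\max_{\Pi:(1,1)\to(m,n)}\ \sum_{(i,j)\in\Pi}w_{ij},$$ where the maximum is over lattice paths $\Pi$ from $(1,1)$ to $(m,n)$ whose steps are of the form $(i,j)\to(i+1,j)$ or $(i,j)\to(i,j+1)$. Then for all integers $m,n\ge 1$ and $a\ge 0$, $$\mathrm{Prob}\bigl(G(m,n)\le a\bigr)=\prod_{i=1}^{n}(1-q_i)^m\; s_{(a^m)}(\underbrace{1,\dots,1}_{m},q_1,\dots,q_n).$$ Here $(a^m)=(a,\dots,a)$ is the partition whose Young diagram is a rectangle with $m$ rows of length $a$, and $s_\lambda(x_1,\dots,x_N)=\sum_T\prod_{c\in\lambda}x_{T(c)}$ is the Schur polynomial, the sum being over semistandard Young tableaux $T$ of shape $\lambda$ with entries in $\{1,\dots,N\}$. -/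

import Mathlib

/-! ### Schur polynomials -/

namespace SchurLPP

/-- Semistandard Young tableaux of shape `μ` with entries in an alphabet of `N` ordered letters
`0 < 1 < ⋯ < N - 1`. -/
def BoundedSSYT (μ : YoungDiagram) (N : ℕ) : Type :=
  {T : SemistandardYoungTableau μ // ∀ c ∈ μ.cells, T c.1 c.2 < N}

instance instFiniteBoundedSSYT (μ : YoungDiagram) (N : ℕ) : Finite (BoundedSSYT μ N) := by
  refine Finite.of_injective
    (fun (T : BoundedSSYT μ N) (c : μ.cells) => (⟨T.1 c.1.1 c.1.2, T.2 c.1 c.2⟩ : Fin N)) ?_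
  intro T T' h
  apply Subtype.ext
  ext i j
  by_cases hc : (i, j) ∈ μ.cells
  · have := congrFun h ⟨(i, j), hc⟩
    simpa using this
  · have hc' : (i, j) ∉ μ := hc
    rw [T.1.zeros hc', T'.1.zeros hc']

noncomputable instance instFintypeBoundedSSYT (μ : YoungDiagram) (N : ℕ) :
    Fintype (BoundedSSYT μ N) :=
  Fintype.ofFinite _

/-- The Schur polynomial `s_μ(x_0, …, x_{N-1})`: the sum, over semistandard Young tableaux `T` of
shape `μ` with entries in the alphabet of `N` letters, of the monomial `∏_{c ∈ μ} x_{T(c)}`. -/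
noncomputable def schurPoly (R : Type*) [CommSemiring R] (μ : YoungDiagram) (N : ℕ) :
    MvPolynomial (Fin N) R :=
  ∑ T : BoundedSSYT μ N, ∏ c : μ.cells, MvPolynomial.X ⟨T.1 c.1.1 c.1.2, T.2 c.1 c.2⟩

/-- The rectangular Young diagram `(a^m)`, with `m` rows of length `a`. -/
def rectDiagram (m a : ℕ) : YoungDiagram where
  cells := Finset.range m ×ˢ Finset.range a
  isLowerSet := by
    rintro ⟨i, j⟩ ⟨i', j'⟩ h hc
    simp only [Prod.mk_le_mk] at h
    simp only [Finset.coe_product, Finset.coe_range, Set.mem_prod, Set.mem_Iio] at hc ⊢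
    exact ⟨h.1.trans_lt hc.1, h.2.trans_lt hc.2⟩

/-! ### Directed last-passage percolation -/

/-- One step `(i, j) → (i + 1, j)` or `(i, j) → (i, j + 1)` of a directed path. -/
def IsStep (u v : ℕ × ℕ) : Prop :=
  v = (u.1 + 1, u.2) ∨ v = (u.1, u.2 + 1)

/-- `P` lists, in order, the vertices of a directed path from `u` to `v`. -/
def IsDirectedPath (P : List (ℕ × ℕ)) (u v : ℕ × ℕ) : Prop :=
  P.head? = some u ∧ P.getLast? = some v ∧ P.IsChain IsStep

/-- The sums of the entries of `x` along directed paths from `(1, 1)` to `(m, n)`. -/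
def pathSums (x : ℕ → ℕ → ℕ) (m n : ℕ) : Set ℕ :=
  {s | ∃ P : List (ℕ × ℕ), IsDirectedPath P (1, 1) (m, n) ∧ s = (P.map fun p => x p.1 p.2).sum}

/-- The last-passage time `G(m, n)` of the array `(x i j)_{i, j ≥ 1}`, the maximum of the path
sums; see `isGreatest_lastPassageTime`. -/
noncomputable def lastPassageTime (x : ℕ → ℕ → ℕ) (m n : ℕ) : ℕ :=
  sSup (pathSums x m n)

theorem isDirectedPath_snoc {P : List (ℕ × ℕ)} {u v v' : ℕ × ℕ} (h : IsDirectedPath P u v)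
    (hs : IsStep v v') : IsDirectedPath (P ++ [v']) u v' := by
  obtain ⟨h1, h2, h3⟩ := h
  refine ⟨by simp [h1], by simp, ?_⟩
  rw [List.isChain_append]
  refine ⟨h3, by simp, ?_⟩
  intro p hp q hq
  simp_all

theorem exists_isDirectedPath (i j : ℕ) : ∃ P, IsDirectedPath P (1, 1) (i + 1, j + 1) := by
  induction i with
  | zero =>
    induction j with
    | zero => exact ⟨[(1, 1)], by simp [IsDirectedPath]⟩
    | succ j ih =>
      obtain ⟨P, hP⟩ := ih
      exact ⟨_, isDirectedPath_snoc hP (Or.inr rfl)⟩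
  | succ i ih =>
    obtain ⟨P, hP⟩ := ih
    exact ⟨_, isDirectedPath_snoc hP (Or.inl rfl)⟩

theorem IsStep.lt {u v : ℕ × ℕ} (h : IsStep u v) : u < v := by
  rcases h with rfl | rfl <;> simp [Prod.lt_iff]

theorem bddAbove_pathSums (x : ℕ → ℕ → ℕ) (m n : ℕ) : BddAbove (pathSums x m n) := by
  refine ⟨∑ p ∈ Finset.Iic (m, n), x p.1 p.2, ?_⟩
  rintro s ⟨P, ⟨-, h2, h3⟩, rfl⟩
  have hlt : P.Pairwise (· < ·) := List.isChain_iff_pairwise.1 (h3.imp fun _ _ h => h.lt)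
  have hnd : P.Nodup := hlt.imp fun h => h.ne
  rw [← List.sum_toFinset _ hnd]
  refine Finset.sum_le_sum_of_subset ?_
  intro p hp
  rw [List.mem_toFinset] at hp
  rw [Finset.mem_Iic]
  obtain ⟨Q, rfl⟩ := List.getLast?_eq_some_iff.1 h2
  rcases List.mem_append.1 hp with hp | hp
  · exact ((List.pairwise_append.1 hlt).2.2 p hp (m, n) (by simp)).le
  · simp_all

/-- The supremum in the definition of the last-passage time is a maximum. -/
theorem isGreatest_lastPassageTime (x : ℕ → ℕ → ℕ) {m n : ℕ} (hm : 1 ≤ m) (hn : 1 ≤ n) :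
    IsGreatest (pathSums x m n) (lastPassageTime x m n) := by
  have hne : (pathSums x m n).Nonempty := by
    obtain ⟨i, rfl⟩ := Nat.exists_eq_add_of_le' hm
    obtain ⟨j, rfl⟩ := Nat.exists_eq_add_of_le' hn
    obtain ⟨P, hP⟩ := exists_isDirectedPath i j
    exact ⟨_, P, hP, rfl⟩
  exact ⟨Nat.sSup_mem hne (bddAbove_pathSums x m n),
    fun _ hs => le_csSup (bddAbove_pathSums x m n) hs⟩

end SchurLPP

/-! The probability is a sum over the `m × n` arrays with last-passage time at most `a`. Such an
array has weight `∏ (1 - q_j)^m` times the product of the `q_j` raised to its column sums, so what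
has to be shown is a generating-function identity.

Two bijections prove it. The Robinson–Schensted–Knuth correspondence, built from local moves that
toggle diagonals, sends these arrays onto the plane partitions in an `m × n` rectangle with entries
at most `a`: every move is invertible and respects monotonicity, rim entries stay equal to
last-passage times, and diagonal sums stay equal to sums over rectangles (`exists_perm_isRecord`).
Next, subtracting `r` from row `r` of a tableau of shape `(a^m)` and conjugating the rows gives such
a plane partition (`bijOn_rowCount`).

The diagonal ending at `(m, j)` then counts the tableau entries among the `j` largest letters, so
each column sum is the multiplicity of one of the last `n` letters; the first `m` letters get weight
1. This attaches `q (n - j)` to column `j + 1`. Rotating the array by 180 degrees keeps the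
last-passage time and reverses the columns, so the symmetry of Schur polynomials is not needed. -/

namespace SchurLPP

/-! ### Local moves and their inverses. -/

/-- The local Robinson–Schensted–Knuth move at the cell `(r + 1, s + 1)`: the entry at this cell is
increased by the larger of its upper and left neighbours, and the earlier entries on its diagonal
are toggled. -/
def cornerMove (r s : ℕ) (f : ℕ → ℕ → ℤ) (i j : ℕ) : ℤ :=
  if i + s = j + r ∧ 0 < i ∧ 0 < j ∧ i ≤ r then
    max (f (i - 1) j) (f i (j - 1)) + min (f (i + 1) j) (f i (j + 1)) - f i j
  else if i = r + 1 ∧ j = s + 1 then max (f r j) (f i s) + f i j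
  else f i j

/-- The inverse of `cornerMove`. -/
def cornerUnmove (r s : ℕ) (f : ℕ → ℕ → ℤ) (i j : ℕ) : ℤ :=
  if i + s = j + r ∧ 0 < i ∧ 0 < j ∧ i ≤ r then
    max (f (i - 1) j) (f i (j - 1)) + min (f (i + 1) j) (f i (j + 1)) - f i j
  else if i = r + 1 ∧ j = s + 1 then f i j - max (f r j) (f i s)
  else f i j

theorem cornerMove_of_diag {r s i j : ℕ} (f : ℕ → ℕ → ℤ)
    (h : i + s = j + r ∧ 0 < i ∧ 0 < j ∧ i ≤ r) :
    cornerMove r s f i j =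
      max (f (i - 1) j) (f i (j - 1)) + min (f (i + 1) j) (f i (j + 1)) - f i j :=
  if_pos h

theorem cornerMove_corner (r s : ℕ) (f : ℕ → ℕ → ℤ) :
    cornerMove r s f (r + 1) (s + 1) =
      max (f r (s + 1)) (f (r + 1) s) + f (r + 1) (s + 1) := by
  simp [cornerMove]

theorem cornerMove_of_ne {r s i j : ℕ} (f : ℕ → ℕ → ℤ)
    (h : ¬(i + s = j + r ∧ 0 < i ∧ 0 < j ∧ i ≤ r + 1)) : cornerMove r s f i j = f i j := by
  rw [cornerMove, if_neg (by omega), if_neg (by omega)]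

theorem cornerUnmove_of_diag {r s i j : ℕ} (f : ℕ → ℕ → ℤ)
    (h : i + s = j + r ∧ 0 < i ∧ 0 < j ∧ i ≤ r) :
    cornerUnmove r s f i j =
      max (f (i - 1) j) (f i (j - 1)) + min (f (i + 1) j) (f i (j + 1)) - f i j :=
  if_pos h

theorem cornerUnmove_corner (r s : ℕ) (f : ℕ → ℕ → ℤ) :
    cornerUnmove r s f (r + 1) (s + 1) =
      f (r + 1) (s + 1) - max (f r (s + 1)) (f (r + 1) s) := by
  simp [cornerUnmove]

theorem cornerUnmove_of_ne {r s i j : ℕ} (f : ℕ → ℕ → ℤ)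
    (h : ¬(i + s = j + r ∧ 0 < i ∧ 0 < j ∧ i ≤ r + 1)) : cornerUnmove r s f i j = f i j := by
  rw [cornerUnmove, if_neg (by omega), if_neg (by omega)]

/-- The local move as a permutation of the set of arrays. -/
def cornerPerm (r s : ℕ) : Equiv.Perm (ℕ → ℕ → ℤ) where
  toFun := cornerMove r s
  invFun := cornerUnmove r s
  left_inv f := by
    funext i j
    by_cases h : i + s = j + r ∧ 0 < i ∧ 0 < j ∧ i ≤ r
    -- The four neighbours lie on the adjacent diagonals, which the move fixes, so the same
    -- reflection is applied twice.
    · rw [cornerUnmove_of_diag _ h, cornerMove_of_diag _ h, cornerMove_of_ne _ (by omega),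
        cornerMove_of_ne _ (by omega), cornerMove_of_ne _ (by omega),
        cornerMove_of_ne _ (by omega)]
      ring
    by_cases h' : i = r + 1 ∧ j = s + 1
    · obtain ⟨rfl, rfl⟩ := h'
      rw [cornerUnmove_corner, cornerMove_corner, cornerMove_of_ne _ (by omega),
        cornerMove_of_ne _ (by omega)]
      ring
    · rw [cornerUnmove_of_ne _ (by omega), cornerMove_of_ne _ (by omega)]
  right_inv f := by
    funext i j
    by_cases h : i + s = j + r ∧ 0 < i ∧ 0 < j ∧ i ≤ r
    · rw [cornerMove_of_diag _ h, cornerUnmove_of_diag _ h, cornerUnmove_of_ne _ (by omega),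
        cornerUnmove_of_ne _ (by omega), cornerUnmove_of_ne _ (by omega),
        cornerUnmove_of_ne _ (by omega)]
      ring
    by_cases h' : i = r + 1 ∧ j = s + 1
    · obtain ⟨rfl, rfl⟩ := h'
      rw [cornerMove_corner, cornerUnmove_corner, cornerUnmove_of_ne _ (by omega),
        cornerUnmove_of_ne _ (by omega)]
      ring
    · rw [cornerMove_of_ne _ (by omega), cornerUnmove_of_ne _ (by omega)]

/-! ### Monotonicity under the local moves. -/

/-- The cells that have been processed when the rows `1, …, r` of length `n` and the first `s` cells
of the row `r + 1` are complete; the two axes are included. -/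
def Stage (n r s i j : ℕ) : Prop :=
  i = 0 ∨ j = 0 ∨ (i ≤ r ∧ j ≤ n) ∨ (i = r + 1 ∧ j ≤ s)

/-- Nonnegative arrays that vanish on the axes and are monotone on the cells of a stage. -/
structure IsMonoOn (n r s : ℕ) (f : ℕ → ℕ → ℤ) : Prop where
  left_axis : ∀ j, f 0 j = 0
  upper_axis : ∀ i, f i 0 = 0
  nonneg : ∀ i j, 0 ≤ f i j
  le_down : ∀ i j, Stage n r s (i + 1) j → f i j ≤ f (i + 1) j
  le_right : ∀ i j, Stage n r s i (j + 1) → f i j ≤ f i (j + 1)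

/-- A toggle reflects an entry in the interval from the larger of its upper and left neighbours to
the smaller of its lower and right ones, hence keeps it there. The new corner dominates its
neighbours because the old entry is nonnegative. -/
theorem IsMonoOn.cornerMove {n r s : ℕ} (hs : s < n) {f : ℕ → ℕ → ℤ} (h : IsMonoOn n r s f) :
    IsMonoOn n r (s + 1) (cornerMove r s f) := by
  have key : ∀ i j, i + s = j + r → i < r →
      0 ≤ SchurLPP.cornerMove r s f (i + 1) (j + 1) ∧
      f i (j + 1) ≤ SchurLPP.cornerMove r s f (i + 1) (j + 1) ∧
      f (i + 1) j ≤ SchurLPP.cornerMove r s f (i + 1) (j + 1) ∧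
      SchurLPP.cornerMove r s f (i + 1) (j + 1) ≤ f (i + 1 + 1) (j + 1) ∧
      SchurLPP.cornerMove r s f (i + 1) (j + 1) ≤ f (i + 1) (j + 1 + 1) := by
    intro i j hij hi
    rw [cornerMove_of_diag _ (by omega)]
    have h1 := h.le_down i (j + 1) (by unfold Stage; omega)
    have h2 := h.le_right (i + 1) j (by unfold Stage; omega)
    have h3 := h.le_down (i + 1) (j + 1) (by unfold Stage; omega)
    have h4 := h.le_right (i + 1) (j + 1) (by unfold Stage; omega)
    have h5 := h.nonneg i (j + 1)
    simp only [Nat.add_sub_cancel]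
    omega
  have key' := cornerMove_corner r s f
  have hn := h.nonneg
  refine ⟨fun j => ?_, fun i => ?_, fun i j => ?_, fun i j hij => ?_, fun i j hij => ?_⟩
  · rw [cornerMove_of_ne _ (by omega), h.left_axis]
  · rw [cornerMove_of_ne _ (by omega), h.upper_axis]
  · by_cases hd : i + s = j + r ∧ 0 < i ∧ 0 < j ∧ i ≤ r + 1
    · obtain ⟨i, rfl⟩ := Nat.exists_eq_add_of_le' (show 1 ≤ i by omega)
      obtain ⟨j, rfl⟩ := Nat.exists_eq_add_of_le' (show 1 ≤ j by omega)
      rcases (show i < r ∨ i = r by omega) with hi | rfl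
      · exact (key i j (by omega) hi).1
      · obtain rfl : j = s := by omega
        have := hn i (j + 1)
        have := hn (i + 1) (j + 1)
        omega
    · rw [cornerMove_of_ne _ hd]
      exact hn i j
  · by_cases hd : i + s = j + r ∧ 0 < i ∧ 0 < j ∧ i ≤ r + 1
    · rw [cornerMove_of_ne f (i := i + 1) (by omega)]
      obtain ⟨i, rfl⟩ := Nat.exists_eq_add_of_le' (show 1 ≤ i by omega)
      obtain ⟨j, rfl⟩ := Nat.exists_eq_add_of_le' (show 1 ≤ j by omega)
      exact (key i j (by omega) (by unfold Stage at hij; omega)).2.2.2.1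
    rw [cornerMove_of_ne _ hd]
    by_cases hd' : i + 1 + s = j + r ∧ 0 < j ∧ i ≤ r
    · obtain ⟨j, rfl⟩ := Nat.exists_eq_add_of_le' (show 1 ≤ j by omega)
      rcases (show i < r ∨ i = r by omega) with hi | rfl
      · exact (key i j (by omega) hi).2.1
      · obtain rfl : j = s := by omega
        have := hn (i + 1) (j + 1)
        omega
    · rw [cornerMove_of_ne _ (by omega)]
      exact h.le_down i j (by unfold Stage at hij ⊢; omega)
  · by_cases hd : i + s = j + r ∧ 0 < i ∧ 0 < j ∧ i ≤ r + 1
    · rw [cornerMove_of_ne f (j := j + 1) (by omega)]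
      obtain ⟨i, rfl⟩ := Nat.exists_eq_add_of_le' (show 1 ≤ i by omega)
      obtain ⟨j, rfl⟩ := Nat.exists_eq_add_of_le' (show 1 ≤ j by omega)
      exact (key i j (by omega) (by unfold Stage at hij; omega)).2.2.2.2
    rw [cornerMove_of_ne _ hd]
    by_cases hd' : i + s = j + 1 + r ∧ 0 < i ∧ i ≤ r + 1
    · obtain ⟨i, rfl⟩ := Nat.exists_eq_add_of_le' (show 1 ≤ i by omega)
      rcases (show i < r ∨ i = r by omega) with hi | rfl
      · exact (key i j (by omega) hi).2.2.1
      · obtain rfl : j = s := by omega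
        have := hn (i + 1) (j + 1)
        omega
    · rw [cornerMove_of_ne _ (by omega)]
      exact h.le_right i j (by unfold Stage at hij ⊢; omega)

theorem IsMonoOn.cornerUnmove {n r s : ℕ} (hs : s < n) {f : ℕ → ℕ → ℤ}
    (h : IsMonoOn n r (s + 1) f) : IsMonoOn n r s (cornerUnmove r s f) := by
  have key : ∀ i j, i + s = j + r → i < r →
      0 ≤ SchurLPP.cornerUnmove r s f (i + 1) (j + 1) ∧
      f i (j + 1) ≤ SchurLPP.cornerUnmove r s f (i + 1) (j + 1) ∧
      f (i + 1) j ≤ SchurLPP.cornerUnmove r s f (i + 1) (j + 1) ∧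
      SchurLPP.cornerUnmove r s f (i + 1) (j + 1) ≤ f (i + 1 + 1) (j + 1) ∧
      SchurLPP.cornerUnmove r s f (i + 1) (j + 1) ≤ f (i + 1) (j + 1 + 1) := by
    intro i j hij hi
    rw [cornerUnmove_of_diag _ (by omega)]
    have h1 := h.le_down i (j + 1) (by unfold Stage; omega)
    have h2 := h.le_right (i + 1) j (by unfold Stage; omega)
    have h3 := h.le_down (i + 1) (j + 1) (by unfold Stage; omega)
    have h4 := h.le_right (i + 1) (j + 1) (by unfold Stage; omega)
    have h5 := h.nonneg i (j + 1)
    simp only [Nat.add_sub_cancel]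
    omega
  have key' := cornerUnmove_corner r s f
  have hn := h.nonneg
  refine ⟨fun j => ?_, fun i => ?_, fun i j => ?_, fun i j hij => ?_, fun i j hij => ?_⟩
  · rw [cornerUnmove_of_ne _ (by omega), h.left_axis]
  · rw [cornerUnmove_of_ne _ (by omega), h.upper_axis]
  · by_cases hd : i + s = j + r ∧ 0 < i ∧ 0 < j ∧ i ≤ r + 1
    · obtain ⟨i, rfl⟩ := Nat.exists_eq_add_of_le' (show 1 ≤ i by omega)
      obtain ⟨j, rfl⟩ := Nat.exists_eq_add_of_le' (show 1 ≤ j by omega)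
      rcases (show i < r ∨ i = r by omega) with hi | rfl
      · exact (key i j (by omega) hi).1
      · obtain rfl : j = s := by omega
        -- The corner already belongs to the stage, so it dominates both neighbours and the
        -- difference is nonnegative.
        have := h.le_down i (j + 1) (by unfold Stage; omega)
        have := h.le_right (i + 1) j (by unfold Stage; omega)
        omega
    · rw [cornerUnmove_of_ne _ hd]
      exact hn i j
  · by_cases hd : i + s = j + r ∧ 0 < i ∧ 0 < j ∧ i ≤ r + 1
    · rw [cornerUnmove_of_ne f (i := i + 1) (by omega)]
      obtain ⟨i, rfl⟩ := Nat.exists_eq_add_of_le' (show 1 ≤ i by omega)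
      obtain ⟨j, rfl⟩ := Nat.exists_eq_add_of_le' (show 1 ≤ j by omega)
      exact (key i j (by omega) (by unfold Stage at hij; omega)).2.2.2.1
    rw [cornerUnmove_of_ne _ hd]
    by_cases hd' : i + 1 + s = j + r ∧ 0 < j ∧ i ≤ r
    · obtain ⟨j, rfl⟩ := Nat.exists_eq_add_of_le' (show 1 ≤ j by omega)
      exact (key i j (by omega) (by unfold Stage at hij; omega)).2.1
    · rw [cornerUnmove_of_ne _ (by omega)]
      exact h.le_down i j (by unfold Stage at hij ⊢; omega)
  · by_cases hd : i + s = j + r ∧ 0 < i ∧ 0 < j ∧ i ≤ r + 1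
    · rw [cornerUnmove_of_ne f (j := j + 1) (by omega)]
      obtain ⟨i, rfl⟩ := Nat.exists_eq_add_of_le' (show 1 ≤ i by omega)
      obtain ⟨j, rfl⟩ := Nat.exists_eq_add_of_le' (show 1 ≤ j by omega)
      exact (key i j (by omega) (by unfold Stage at hij; omega)).2.2.2.2
    rw [cornerUnmove_of_ne _ hd]
    by_cases hd' : i + s = j + 1 + r ∧ 0 < i ∧ i ≤ r + 1
    · obtain ⟨i, rfl⟩ := Nat.exists_eq_add_of_le' (show 1 ≤ i by omega)
      exact (key i j (by omega) (by unfold Stage at hij; omega)).2.2.1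
    · rw [cornerUnmove_of_ne _ (by omega)]
      exact h.le_right i j (by unfold Stage at hij ⊢; omega)

theorem isMonoOn_cornerPerm_iff {n r s : ℕ} (hs : s < n) (f : ℕ → ℕ → ℤ) :
    IsMonoOn n r (s + 1) (cornerPerm r s f) ↔ IsMonoOn n r s f :=
  ⟨fun h => by simpa [cornerPerm] using (cornerPerm r s).left_inv f ▸ h.cornerUnmove hs,
    fun h => h.cornerMove hs⟩

/-! ### Last-passage times and diagonal sums under the local moves. -/

/-- The last-passage times of an array, by their recursion. -/
def passage (f : ℕ → ℕ → ℤ) : ℕ → ℕ → ℤ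
  | 0, _ => 0
  | _ + 1, 0 => 0
  | i + 1, j + 1 => max (passage f i (j + 1)) (passage f (i + 1) j) + f (i + 1) (j + 1)

/-- The sum of the entries of an array on the diagonal that ends at a given cell. -/
def diagSum (f : ℕ → ℕ → ℤ) : ℕ → ℕ → ℤ
  | 0, _ => 0
  | _ + 1, 0 => 0
  | i + 1, j + 1 => diagSum f i j + f (i + 1) (j + 1)

/-- The sum of the entries of an array in the rows `1, …, i` and columns `1, …, j`. -/
def boxSum (f : ℕ → ℕ → ℤ) (i j : ℕ) : ℤ :=
  ∑ k ∈ Finset.range i, ∑ l ∈ Finset.range j, f (k + 1) (l + 1)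

@[simp] theorem passage_zero_right (f : ℕ → ℕ → ℤ) (i : ℕ) : passage f i 0 = 0 := by
  cases i <;> simp [passage]

@[simp] theorem passage_zero_left (f : ℕ → ℕ → ℤ) (j : ℕ) : passage f 0 j = 0 := by
  cases j <;> simp [passage]

@[simp] theorem diagSum_zero_right (f : ℕ → ℕ → ℤ) (i : ℕ) : diagSum f i 0 = 0 := by
  cases i <;> simp [diagSum]

@[simp] theorem diagSum_zero_left (f : ℕ → ℕ → ℤ) (j : ℕ) : diagSum f 0 j = 0 := by
  cases j <;> simp [diagSum]

theorem boxSum_succ_succ (f : ℕ → ℕ → ℤ) (i j : ℕ) :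
    boxSum f (i + 1) (j + 1) + boxSum f i j =
      boxSum f i (j + 1) + boxSum f (i + 1) j + f (i + 1) (j + 1) := by
  simp only [boxSum, Finset.sum_range_succ, Finset.sum_add_distrib]
  ring

theorem diagSum_congr {f g : ℕ → ℕ → ℤ} : ∀ {i j : ℕ},
    (∀ k l, k + j = l + i → 0 < k → 0 < l → k ≤ i → f k l = g k l) →
      diagSum f i j = diagSum g i j
  | 0, _, _ => by simp
  | _ + 1, 0, _ => by simp
  | i + 1, j + 1, h => by
    rw [diagSum, diagSum, h (i + 1) (j + 1) (by omega) (by omega) (by omega) le_rfl,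
      diagSum_congr (f := f) (g := g) (i := i) (j := j)
        fun k l h1 h2 h3 h4 => h k l (by omega) h2 h3 (by omega)]

/-- The minimum at one diagonal cell and the maximum at the next are taken over the same two
entries, so together they give the sum of these entries. The diagonal telescopes and only its last
minimum survives. -/
theorem diagSum_cornerMove_of_le {r s : ℕ} {f : ℕ → ℕ → ℤ} (h0 : ∀ j, f 0 j = 0)
    (h0' : ∀ i, f i 0 = 0) (hf : ∀ i j, 0 ≤ f i j) : ∀ {i j : ℕ}, i + s = j + r → i ≤ r →
      diagSum (cornerMove r s f) i j + diagSum f i j =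
        diagSum f (i - 1) j + diagSum f i (j - 1) + min (f (i + 1) j) (f i (j + 1))
  | 0, j, _, _ => by
    have := hf 1 j
    simp [h0, this]
  | i + 1, 0, _, _ => by
    have := hf (i + 1) 1
    simp [h0', this]
  | i + 1, j + 1, hij, hi => by
    have ih := diagSum_cornerMove_of_le (r := r) (s := s) h0 h0' hf (i := i) (j := j)
      (by omega) (by omega)
    have e1 : diagSum f i (j + 1) = diagSum f (i - 1) j + f i (j + 1) := by
      cases i <;> simp [diagSum, h0]
    have e2 : diagSum f (i + 1) j = diagSum f i (j - 1) + f (i + 1) j := by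
      cases j <;> simp [diagSum, h0']
    have e3 := cornerMove_of_diag (r := r) (s := s) (i := i + 1) (j := j + 1) f (by omega)
    simp only [diagSum, Nat.add_sub_cancel] at e3 ⊢
    omega

/-- The surviving minimum pairs with the maximum at the corner, which leaves the inclusion-exclusion
recursion of `boxSum_succ_succ`. -/
theorem diagSum_cornerMove {r s : ℕ} {f : ℕ → ℕ → ℤ} (h0 : ∀ j, f 0 j = 0)
    (h0' : ∀ i, f i 0 = 0) (hf : ∀ i j, 0 ≤ f i j) :
    diagSum (cornerMove r s f) (r + 1) (s + 1) + diagSum f r s =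
      diagSum f r (s + 1) + diagSum f (r + 1) s + f (r + 1) (s + 1) := by
  have ih := diagSum_cornerMove_of_le h0 h0' hf (r := r) (s := s) (i := r) (j := s)
    (by omega) le_rfl
  have e1 : diagSum f r (s + 1) = diagSum f (r - 1) s + f r (s + 1) := by
    cases r <;> simp [diagSum, h0]
  have e2 : diagSum f (r + 1) s = diagSum f r (s - 1) + f (r + 1) s := by
    cases s <;> simp [diagSum, h0']
  have e3 := cornerMove_corner r s f
  simp only [diagSum]
  omega

/-- The entries on the rim of a stage are last-passage times, the diagonal sums ending there are sums
over rectangles, and the unprocessed entries are unchanged. -/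
structure IsRecord (n r s : ℕ) (f g : ℕ → ℕ → ℤ) : Prop where
  rim : ∀ i j, Stage n r s i j → ¬Stage n r s (i + 1) (j + 1) → g i j = passage f i j
  diag : ∀ i j, Stage n r s i j → ¬Stage n r s (i + 1) (j + 1) → diagSum g i j = boxSum f i j
  rest : ∀ i j, ¬Stage n r s i j → g i j = f i j

theorem IsRecord.cornerMove {n r s : ℕ} (hs : s < n) {f g : ℕ → ℕ → ℤ} (hg : IsMonoOn n r s g)
    (h : IsRecord n r s f g) : IsRecord n r (s + 1) f (cornerMove r s g) := by
  have hc : g (r + 1) (s + 1) = f (r + 1) (s + 1) := h.rest _ _ (by unfold Stage; omega)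
  refine ⟨fun i j h1 h2 => ?_, fun i j h1 h2 => ?_, fun i j h1 => ?_⟩
  · by_cases hd : i = r + 1 ∧ j = s + 1
    · obtain ⟨rfl, rfl⟩ := hd
      rw [cornerMove_corner, passage, hc, h.rim r (s + 1), h.rim (r + 1) s] <;>
        unfold Stage <;> omega
    -- Below the corner's own case, a rim cell is untouched: every other cell of the toggled
    -- diagonal has its diagonal successor already processed.
    · rw [cornerMove_of_ne _ (by unfold Stage at h1 h2; omega)]
      exact h.rim i j (by unfold Stage at *; omega) (by unfold Stage at *; omega)
  · by_cases hd : i = r + 1 ∧ j = s + 1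
    · obtain ⟨rfl, rfl⟩ := hd
      have h3 := diagSum_cornerMove hg.left_axis hg.upper_axis hg.nonneg (r := r) (s := s)
      have h4 := boxSum_succ_succ f r s
      rw [hc, h.diag r s (by unfold Stage; omega) (by unfold Stage; omega),
        h.diag r (s + 1) (by unfold Stage; omega) (by unfold Stage; omega),
        h.diag (r + 1) s (by unfold Stage; omega) (by unfold Stage; omega)] at h3
      omega
    · rw [diagSum_congr (g := g)]
      · exact h.diag i j (by unfold Stage at *; omega) (by unfold Stage at *; omega)
      · intro k l h3 h4 h5 h6
        exact cornerMove_of_ne _ (by unfold Stage at h1 h2; omega)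
  · rw [cornerMove_of_ne _ (by unfold Stage at h1; omega)]
    exact h.rest i j (by unfold Stage at *; omega)

/-- The Robinson–Schensted–Knuth correspondence, up to a given stage. -/
theorem exists_perm_isRecord (n : ℕ) : ∀ r s : ℕ, s ≤ n → ∃ Φ : Equiv.Perm (ℕ → ℕ → ℤ),
    (∀ f, IsMonoOn n r s (Φ f) ↔ IsMonoOn n 0 0 f) ∧
      ∀ f, IsMonoOn n 0 0 f → IsRecord n r s f (Φ f)
  | 0, 0, _ => by
    refine ⟨Equiv.refl _, fun f => Iff.rfl, fun f hf => ⟨fun i j h1 h2 => ?_, fun i j h1 h2 => ?_,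
      fun i j _ => rfl⟩⟩
    all_goals
      rcases (show i = 0 ∨ j = 0 by unfold Stage at *; omega) with rfl | rfl <;>
        simp [hf.left_axis, hf.upper_axis, boxSum]
  | r + 1, 0, _ => by
    obtain ⟨Φ, h1, h2⟩ := exists_perm_isRecord n r n le_rfl
    have hS : ∀ i j, Stage n (r + 1) 0 i j ↔ Stage n r n i j := fun i j => by
      unfold Stage; omega
    refine ⟨Φ, fun f => ?_, fun f hf => ?_⟩
    · rw [← h1 f]
      constructor <;> rintro ⟨a1, a2, a3, a4, a5⟩ <;> exact ⟨a1, a2, a3, by simpa only [hS] using a4,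
        by simpa only [hS] using a5⟩
    · obtain ⟨a1, a2, a3⟩ := h2 f hf
      exact ⟨by simpa only [hS] using a1, by simpa only [hS] using a2, by simpa only [hS] using a3⟩
  | r, s + 1, hs => by
    obtain ⟨Φ, h1, h2⟩ := exists_perm_isRecord n r s (by omega)
    exact ⟨Φ.trans (cornerPerm r s), fun f => (isMonoOn_cornerPerm_iff hs _).trans (h1 f),
      fun f hf => (h2 f hf).cornerMove hs ((h1 f).2 hf)⟩

/-! ### From bounded last-passage times to plane partitions. -/

/-- Nonnegative arrays supported in the rectangle `m × n` with last-passage time at most `a`. -/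
def passageSet (m n a : ℕ) : Set (ℕ → ℕ → ℤ) :=
  {f | IsMonoOn n 0 0 f ∧ (∀ i j, m < i ∨ n < j → f i j = 0) ∧ passage f m n ≤ a}

/-- Plane partitions in the rectangle `m × n` with entries at most `a`, with rows and columns
increasing. -/
def planePartitionSet (m n a : ℕ) : Set (ℕ → ℕ → ℤ) :=
  {f | IsMonoOn n m 0 f ∧ (∀ i j, m < i ∨ n < j → f i j = 0) ∧ f m n ≤ a}

/-- The correspondence permutes all integer arrays, so it is enough that membership in the two sets
is equivalent; surjectivity comes from the global inverse. -/
theorem exists_bijOn_passageSet (m n a : ℕ) : ∃ Φ : (ℕ → ℕ → ℤ) → ℕ → ℕ → ℤ,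
    Set.BijOn Φ (passageSet m n a) (planePartitionSet m n a) ∧
      ∀ f ∈ passageSet m n a, ∀ j ≤ n, diagSum (Φ f) m j = boxSum f m j := by
  obtain ⟨Φ, h1, h2⟩ := exists_perm_isRecord n m 0 (Nat.zero_le n)
  have hrim : ∀ f, IsMonoOn n 0 0 f → Φ f m n = passage f m n := fun f hf => by
    rcases Nat.eq_zero_or_pos n with rfl | hn
    · rw [((h1 f).2 hf).upper_axis, passage_zero_right]
    · exact (h2 f hf).rim m n (by unfold Stage; omega) (by unfold Stage; omega)
  have hoff : ∀ f, IsMonoOn n 0 0 f →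
      ((∀ i j, m < i ∨ n < j → Φ f i j = 0) ↔ ∀ i j, m < i ∨ n < j → f i j = 0) := fun f hf => by
    refine forall_congr' fun i => forall_congr' fun j => imp_congr_right fun hij => ?_
    by_cases h0 : i = 0 ∨ j = 0
    · rcases h0 with rfl | rfl
      · rw [((h1 f).2 hf).left_axis, hf.left_axis]
      · rw [((h1 f).2 hf).upper_axis, hf.upper_axis]
    · rw [(h2 f hf).rest i j (by unfold Stage; omega)]
  have hiff : ∀ f, Φ f ∈ planePartitionSet m n a ↔ f ∈ passageSet m n a := fun f => by
    simp only [planePartitionSet, passageSet, Set.mem_ofPred_eq, h1]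
    refine and_congr_right fun hf => ?_
    rw [hoff f hf, hrim f hf]
  refine ⟨Φ, ⟨fun f hf => (hiff f).2 hf, Φ.injective.injOn, fun g hg => ?_⟩, fun f hf j hj => ?_⟩
  · refine ⟨Φ.symm g, (hiff _).1 ?_, Φ.apply_symm_apply g⟩
    rwa [Φ.apply_symm_apply]
  · rcases Nat.eq_zero_or_pos j with rfl | hn
    · simp [boxSum]
    · exact (h2 f hf.1).diag m j (by unfold Stage; omega) (by unfold Stage; omega)

/-! ### Plane partitions as tableaux of rectangular shape. -/

/-- An upward closed subset of `range N` is a final segment, determined by its size. This is the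
mechanism of conjugation, used in both directions below. -/
theorem iff_le_add_card_filter_range {P : ℕ → Prop} [DecidablePred P] {N : ℕ}
    (hP : ∀ x y, x ≤ y → y < N → P x → P y) {x : ℕ} (hx : x < N) :
    P x ↔ N ≤ x + ((Finset.range N).filter P).card := by
  constructor
  · intro h
    have h1 : Finset.Ico x N ⊆ (Finset.range N).filter P := fun y hy => by
      rw [Finset.mem_Ico] at hy
      rw [Finset.mem_filter, Finset.mem_range]
      exact ⟨hy.2, hP x y hy.1 hy.2 h⟩
    have h2 := Finset.card_le_card h1
    rw [Nat.card_Ico] at h2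
    omega
  · intro h
    by_contra hn
    have h1 : (Finset.range N).filter P ⊆ Finset.Ico (x + 1) N := fun y hy => by
      rw [Finset.mem_filter, Finset.mem_range] at hy
      rw [Finset.mem_Ico]
      refine ⟨?_, hy.1⟩
      by_contra hlt
      exact hn (hP y x (by omega) hx hy.2)
    have h2 := Finset.card_le_card h1
    rw [Nat.card_Ico] at h2
    omega

theorem mem_rectDiagram {m a i j : ℕ} : (i, j) ∈ rectDiagram m a ↔ i < m ∧ j < a := by
  rw [← YoungDiagram.mem_cells]
  simp [rectDiagram]

/-- Strict columns confine row `r` to the values `r, …, r + n`, so the shifted rows conjugate into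
`n` columns. -/
theorem add_le_entry {m a : ℕ} (T : SemistandardYoungTableau (rectDiagram m a)) {r c : ℕ}
    (hc : c < a) : ∀ k, r + k < m → T r c + k ≤ T (r + k) c
  | 0, _ => le_rfl
  | k + 1, h => by
    have h1 := add_le_entry T (r := r) hc k (by omega)
    have h2 := T.col_strict (i1 := r + k) (i2 := r + (k + 1)) (j := c) (by omega)
      (mem_rectDiagram.2 ⟨h, hc⟩)
    omega

theorem le_entry {m a : ℕ} (T : SemistandardYoungTableau (rectDiagram m a)) {r c : ℕ} (hr : r < m)
    (hc : c < a) : r ≤ T r c := by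
  have := add_le_entry T (r := 0) hc r (by omega)
  simp only [Nat.zero_add] at this
  omega

theorem entry_le {m n a : ℕ} (T : BoundedSSYT (rectDiagram m a) (m + n)) {r c : ℕ} (hr : r < m)
    (hc : c < a) : T.1 r c ≤ r + n := by
  have h1 := add_le_entry T.1 (r := r) hc (m - 1 - r) (by omega)
  have h2 := T.2 (m - 1, c) (mem_rectDiagram.2 ⟨by omega, hc⟩)
  rw [show r + (m - 1 - r) = m - 1 by omega] at h1
  simp only at h2
  omega

/-- The number of entries in the row `i - 1` of a tableau that are at least `i + n - j`. -/
def rowCount (m n a : ℕ) (T : ℕ → ℕ → ℕ) (i j : ℕ) : ℤ :=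
  if 0 < i ∧ i ≤ m ∧ 0 < j ∧ j ≤ n then
    (((Finset.range a).filter fun c => i + n ≤ T (i - 1) c + j).card : ℤ)
  else 0

theorem rowCount_succ {m n a i j : ℕ} (T : ℕ → ℕ → ℕ) (hi : i < m) (hj : j < n) :
    rowCount m n a T (i + 1) (j + 1) =
      (((Finset.range a).filter fun c => i + n ≤ T i c + j).card : ℤ) := by
  rw [rowCount, if_pos (by omega)]
  congr 3
  funext c
  rw [Nat.add_sub_cancel, eq_iff_iff]
  omega

theorem rowCount_eq_zero {m n a i j : ℕ} (T : ℕ → ℕ → ℕ) (h : i = 0 ∨ j = 0 ∨ m < i ∨ n < j) :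
    rowCount m n a T i j = 0 :=
  if_neg (by omega)

theorem rowCount_mem {m n a : ℕ} (T : BoundedSSYT (rectDiagram m a) (m + n)) :
    rowCount m n a (fun i j => T.1 i j) ∈ planePartitionSet m n a := by
  have hnn : ∀ i j, 0 ≤ rowCount m n a (fun i j => T.1 i j) i j := fun i j => by
    unfold rowCount
    split_ifs <;> positivity
  refine ⟨⟨fun j => rowCount_eq_zero _ (by omega), fun i => rowCount_eq_zero _ (by omega), hnn,
    fun i j hij => ?_, fun i j hij => ?_⟩, fun i j hij => rowCount_eq_zero _ (by omega), ?_⟩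
  · by_cases h : i = 0 ∨ j = 0
    · rw [rowCount_eq_zero (i := i) (j := j) _ (by omega)]
      exact hnn _ _
    · obtain ⟨i, rfl⟩ := Nat.exists_eq_add_of_le' (show 1 ≤ i by omega)
      obtain ⟨j, rfl⟩ := Nat.exists_eq_add_of_le' (show 1 ≤ j by omega)
      unfold Stage at hij
      rw [rowCount_succ _ (by omega) (by omega), rowCount_succ _ (by omega) (by omega)]
      refine Nat.cast_le.2 (Finset.card_le_card fun c hc => ?_)
      rw [Finset.mem_filter, Finset.mem_range] at hc ⊢
      have := T.1.col_strict (i1 := i) (i2 := i + 1) (j := c) (by omega)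
        (mem_rectDiagram.2 ⟨by omega, hc.1⟩)
      omega
  · by_cases h : i = 0 ∨ j = 0
    · rw [rowCount_eq_zero (i := i) (j := j) _ (by omega)]
      exact hnn _ _
    · obtain ⟨i, rfl⟩ := Nat.exists_eq_add_of_le' (show 1 ≤ i by omega)
      obtain ⟨j, rfl⟩ := Nat.exists_eq_add_of_le' (show 1 ≤ j by omega)
      unfold Stage at hij
      rw [rowCount_succ _ (by omega) (by omega), rowCount_succ _ (by omega) (by omega)]
      refine Nat.cast_le.2 (Finset.card_le_card fun c hc => ?_)
      rw [Finset.mem_filter, Finset.mem_range] at hc ⊢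
      omega
  · unfold rowCount
    split_ifs
    · exact Nat.cast_le.2 ((Finset.card_filter_le _ _).trans_eq (Finset.card_range a))
    · positivity

theorem le_entry_iff {m n a : ℕ} (T : BoundedSSYT (rectDiagram m a) (m + n)) {r c j : ℕ}
    (hr : r < m) (hc : c < a) (hj : j < n) :
    r + n ≤ T.1 r c + j ↔ (a : ℤ) ≤ c + rowCount m n a (fun i j => T.1 i j) (r + 1) (j + 1) := by
  rw [rowCount_succ _ hr hj, iff_le_add_card_filter_range
    (P := fun c => r + n ≤ T.1 r c + j) (N := a) (fun x y hxy hy h => ?_) hc]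
  · exact_mod_cast Iff.rfl
  · have := T.1.row_weak_of_le hxy (mem_rectDiagram.2 ⟨hr, hy⟩)
    omega

theorem rowCount_injective (m n a : ℕ) : Function.Injective
    fun T : BoundedSSYT (rectDiagram m a) (m + n) => rowCount m n a (fun i j => T.1 i j) := by
  have key : ∀ T T' : BoundedSSYT (rectDiagram m a) (m + n),
      rowCount m n a (fun i j => T.1 i j) = rowCount m n a (fun i j => T'.1 i j) →
      ∀ r c, r < m → c < a → T.1 r c ≤ T'.1 r c := by
    intro T T' h r c hr hc
    by_contra hlt
    have h1 := entry_le T hr hc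
    have h2 := le_entry T'.1 hr hc
    -- This `j` puts the threshold exactly at the entry of `T`, which the smaller entry of `T'`
    -- misses.
    have h3 := le_entry_iff T hr hc (j := r + n - T.1 r c) (by omega)
    have h4 := le_entry_iff T' hr hc (j := r + n - T.1 r c) (by omega)
    rw [h, ← h4] at h3
    omega
  intro T T' h
  refine Subtype.ext (SemistandardYoungTableau.ext fun r c => ?_)
  by_cases hrc : r < m ∧ c < a
  · exact le_antisymm (key T T' h r c hrc.1 hrc.2) (key T' T h.symm r c hrc.1 hrc.2)
  · rw [T.1.zeros (mt mem_rectDiagram.1 hrc), T'.1.zeros (mt mem_rectDiagram.1 hrc)]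

theorem IsMonoOn.le_down_of_le {n m : ℕ} {f : ℕ → ℕ → ℤ} (h : IsMonoOn n m 0 f) {j : ℕ}
    (hj : j ≤ n) {i i' : ℕ} (hii : i ≤ i') (hi : i' ≤ m) : f i j ≤ f i' j := by
  induction i', hii using Nat.le_induction with
  | base => rfl
  | succ k hk ih =>
    exact (ih (by omega)).trans (h.le_down k j (by unfold Stage; omega))

theorem IsMonoOn.le_right_of_le {n m : ℕ} {f : ℕ → ℕ → ℤ} (h : IsMonoOn n m 0 f) {i : ℕ}
    (hi : i ≤ m) {j j' : ℕ} (hjj : j ≤ j') (hj : j' ≤ n) : f i j ≤ f i j' := by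
  induction j', hjj using Nat.le_induction with
  | base => rfl
  | succ k hk ih =>
    exact (ih (by omega)).trans (h.le_right i k (by unfold Stage; omega))

theorem exists_rowCount_eq {m n a : ℕ} {f : ℕ → ℕ → ℤ} (hf : f ∈ planePartitionSet m n a) :
    ∃ T : BoundedSSYT (rectDiagram m a) (m + n), rowCount m n a (fun i j => T.1 i j) = f := by
  obtain ⟨hmono, hoff, ha⟩ := hf
  -- The conjugate of row `r + 1` of `f`; adding `r` back makes the columns strict.
  let N : ℕ → ℕ → ℕ := fun r c =>
    ((Finset.range n).filter fun j => (a : ℤ) ≤ c + f (r + 1) (j + 1)).card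
  have hNle : ∀ r c, N r c ≤ n := fun r c =>
    (Finset.card_filter_le _ _).trans_eq (Finset.card_range n)
  let T : BoundedSSYT (rectDiagram m a) (m + n) := ⟨{
      entry := fun r c => if r < m ∧ c < a then r + N r c else 0
      row_weak' := fun {i j1 j2} hlt hc => by
        rw [mem_rectDiagram] at hc
        rw [if_pos (by omega), if_pos hc]
        refine Nat.add_le_add_left (Finset.card_le_card fun j hj => ?_) _
        rw [Finset.mem_filter] at hj ⊢
        exact ⟨hj.1, by omega⟩
      col_strict' := fun {i1 i2 j} hlt hc => by
        rw [mem_rectDiagram] at hc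
        rw [if_pos (by omega), if_pos hc]
        refine Nat.add_lt_add_of_lt_of_le hlt (Finset.card_le_card fun k hk => ?_)
        rw [Finset.mem_filter, Finset.mem_range] at hk ⊢
        have := hmono.le_down_of_le (j := k + 1) (by omega) (i := i1 + 1) (i' := i2 + 1)
          (by omega) (by omega)
        omega
      zeros' := fun h => if_neg (mt mem_rectDiagram.2 h) }, fun c hc => by
    have hc' := mem_rectDiagram.1 hc
    change (if c.1 < m ∧ c.2 < a then c.1 + N c.1 c.2 else 0) < m + n
    rw [if_pos hc']
    have := hNle c.1 c.2
    omega⟩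
  have hT : ∀ r c, r < m → c < a → T.1 r c = r + N r c := fun r c hr hc => if_pos ⟨hr, hc⟩
  refine ⟨T, ?_⟩
  funext i j
  by_cases h : i = 0 ∨ j = 0 ∨ m < i ∨ n < j
  · rw [rowCount_eq_zero _ h]
    rcases h with rfl | rfl | h
    · rw [hmono.left_axis]
    · rw [hmono.upper_axis]
    · rw [hoff i j h]
  obtain ⟨i, rfl⟩ := Nat.exists_eq_add_of_le' (show 1 ≤ i by omega)
  obtain ⟨j, rfl⟩ := Nat.exists_eq_add_of_le' (show 1 ≤ j by omega)
  have hfa : f (i + 1) (j + 1) ≤ a :=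
    ((hmono.le_down_of_le (by omega) (by omega) le_rfl).trans
      (hmono.le_right_of_le le_rfl (by omega) le_rfl)).trans ha
  have hf0 := hmono.nonneg (i + 1) (j + 1)
  rw [rowCount_succ _ (by omega) (by omega)]
  have hset : ((Finset.range a).filter fun c => i + n ≤ T.1 i c + j) =
      Finset.Ico (a - (f (i + 1) (j + 1)).toNat) a := by
    ext c
    rw [Finset.mem_filter, Finset.mem_range, Finset.mem_Ico, and_comm]
    refine and_congr_left fun hc => ?_
    have h1 := iff_le_add_card_filter_range (P := fun j => (a : ℤ) ≤ c + f (i + 1) (j + 1))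
      (N := n) (fun x y hxy hy hx => by
        have := hmono.le_right_of_le (i := i + 1) (by omega) (j := x + 1) (j' := y + 1)
          (by omega) (by omega)
        omega) (x := j) (by omega)
    have h2 := hT i c (by omega) hc
    change _ ↔ n ≤ j + N i c at h1
    omega
  rw [hset, Nat.card_Ico]
  omega

theorem bijOn_rowCount (m n a : ℕ) : Set.BijOn
    (fun T : BoundedSSYT (rectDiagram m a) (m + n) => rowCount m n a (fun i j => T.1 i j))
    Set.univ (planePartitionSet m n a) :=
  ⟨fun T _ => rowCount_mem T, (rowCount_injective m n a).injOn, fun _ hf =>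
    let ⟨T, hT⟩ := exists_rowCount_eq hf
    ⟨T, trivial, hT⟩⟩

/-- The threshold `i + n - j` in `rowCount` is constant along a diagonal, so the diagonal sum counts
entries of all rows against one bound. -/
theorem diagSum_rowCount {m n a : ℕ} (T : BoundedSSYT (rectDiagram m a) (m + n)) : ∀ {i j : ℕ},
    i ≤ m → j ≤ n → diagSum (rowCount m n a fun i j => T.1 i j) i j =
      ∑ r ∈ Finset.range i, (((Finset.range a).filter fun c => i + n ≤ T.1 r c + j).card : ℤ)
  | 0, _, _, _ => by simp
  -- The diagonal stops at the axis; the remaining rows have no entry as large as the bound.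
  | i + 1, 0, hi, _ => by
    rw [diagSum_zero_right]
    refine (Finset.sum_eq_zero fun r hr => ?_).symm
    rw [Finset.mem_range] at hr
    rw [Nat.cast_eq_zero, Finset.card_eq_zero, Finset.filter_eq_empty_iff]
    intro c hc
    have := entry_le T (r := r) (c := c) (by omega) (Finset.mem_range.1 hc)
    omega
  | i + 1, j + 1, hi, hj => by
    rw [diagSum, diagSum_rowCount T (by omega) (by omega), Finset.sum_range_succ,
      rowCount_succ _ (by omega) (by omega)]
    have h : ∀ r c, (i + 1 + n ≤ T.1 r c + (j + 1)) = (i + n ≤ T.1 r c + j) := fun r c => by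
      rw [eq_iff_iff]; omega
    simp only [h]

theorem diagSum_rowCount_sub {m n a : ℕ} (T : BoundedSSYT (rectDiagram m a) (m + n)) {j : ℕ}
    (hj : j < n) : diagSum (rowCount m n a fun i j => T.1 i j) m (j + 1) -
      diagSum (rowCount m n a fun i j => T.1 i j) m j =
      (((rectDiagram m a).cells.filter fun c => T.1 c.1 c.2 + j + 1 = m + n).card : ℤ) := by
  rw [diagSum_rowCount T le_rfl hj, diagSum_rowCount T le_rfl hj.le, ← Finset.sum_sub_distrib]
  simp only [rectDiagram, Finset.card_filter, Nat.cast_sum, ← Finset.sum_sub_distrib,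
    Finset.sum_product]
  refine Finset.sum_congr rfl fun r _ => Finset.sum_congr rfl fun c _ => ?_
  split_ifs <;> omega

/-! ### Lattice paths and the rotated array. -/

theorem passage_succ_succ (f : ℕ → ℕ → ℤ) (i j : ℕ) : passage f (i + 1) (j + 1) =
    max (passage f i (j + 1)) (passage f (i + 1) j) + f (i + 1) (j + 1) := by
  rw [passage]

theorem passage_nonneg {f : ℕ → ℕ → ℤ} (hf : ∀ i j, 0 ≤ f i j) : ∀ i j, 0 ≤ passage f i j
  | 0, _ => by simp
  | _ + 1, 0 => by simp
  | i + 1, j + 1 => by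
    rw [passage]
    exact add_nonneg (le_max_of_le_left (passage_nonneg hf i (j + 1))) (hf _ _)

/-- The array `(x i j)` restricted to the rectangle `m × n` and rotated by 180 degrees. -/
def rotate (m n : ℕ) (x : ℕ → ℕ → ℕ) (i j : ℕ) : ℤ :=
  if 0 < i ∧ i ≤ m ∧ 0 < j ∧ j ≤ n then (x (m + 1 - i) (n + 1 - j) : ℤ) else 0

theorem rotate_nonneg (m n : ℕ) (x : ℕ → ℕ → ℕ) (i j : ℕ) : 0 ≤ rotate m n x i j := by
  unfold rotate
  split_ifs <;> positivity

theorem rotate_succ_succ {m n i j : ℕ} (x : ℕ → ℕ → ℕ) (hi : i < m) (hj : j < n) :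
    rotate m n x (i + 1) (j + 1) = x (m - i) (n - j) := by
  rw [rotate, if_pos (by omega), Nat.add_sub_add_right, Nat.add_sub_add_right]

theorem rotate_eq_zero {m n i j : ℕ} (x : ℕ → ℕ → ℕ) (h : i = 0 ∨ j = 0 ∨ m < i ∨ n < j) :
    rotate m n x i j = 0 :=
  if_neg (by omega)

theorem isDirectedPath_cons {P : List (ℕ × ℕ)} {u u' v : ℕ × ℕ} (h : IsDirectedPath P u v)
    (hs : IsStep u' u) : IsDirectedPath (u' :: P) u' v := by
  obtain ⟨h1, h2, h3⟩ := h
  cases P with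
  | nil => simp at h1
  | cons p P =>
    obtain rfl : p = u := by simpa using h1
    exact ⟨rfl, by simpa using h2, List.isChain_cons_cons.2 ⟨hs, h3⟩⟩

/-- Rotation turns the first vertex of a path into the last cell of the recursion, so peeling the
head of the list matches unfolding `passage`. -/
theorem sum_path_le_passage {m n : ℕ} (x : ℕ → ℕ → ℕ) : ∀ (P : List (ℕ × ℕ)) (k l : ℕ),
    0 < k → 0 < l → IsDirectedPath P (k, l) (m, n) → k ≤ m ∧ l ≤ n ∧
      (((P.map fun p => x p.1 p.2).sum : ℕ) : ℤ) ≤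
        passage (rotate m n x) (m + 1 - k) (n + 1 - l)
  | [], _, _, _, _, h => by simp [IsDirectedPath] at h
  | [v], k, l, hk, hl, h => by
    obtain ⟨h1, h2, -⟩ := h
    obtain rfl : v = (k, l) := by simpa using h1
    obtain ⟨rfl, rfl⟩ : k = m ∧ l = n := by simpa using h2
    have h3 := rotate_succ_succ (m := k) (n := l) x (i := 0) (j := 0) hk hl
    simp only [Nat.zero_add, Nat.sub_zero] at h3
    simp [show k + 1 - k = 0 + 1 by omega, show l + 1 - l = 0 + 1 by omega, passage, h3]
  | v :: v' :: Q, k, l, hk, hl, h => by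
    obtain ⟨h1, h2, h3⟩ := h
    obtain rfl : v = (k, l) := by simpa using h1
    rw [List.isChain_cons_cons] at h3
    have ih := sum_path_le_passage (m := m) (n := n) x (v' :: Q)
    rcases h3.1 with rfl | rfl
    · obtain ⟨i1, i2, i3⟩ := ih (k + 1) l (by omega) hl ⟨rfl, by simpa using h2, h3.2⟩
      refine ⟨by omega, i2, ?_⟩
      have h4 := rotate_succ_succ (m := m) (n := n) x (i := m - k) (j := n - l)
        (by omega) (by omega)
      rw [Nat.sub_sub_self (by omega), Nat.sub_sub_self i2] at h4
      rw [show m + 1 - (k + 1) = m - k by omega, show n + 1 - l = n - l + 1 by omega] at i3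
      rw [show m + 1 - k = m - k + 1 by omega, show n + 1 - l = n - l + 1 by omega, passage, h4,
        List.map_cons, List.sum_cons, Nat.cast_add, add_comm]
      exact add_le_add_left (i3.trans (le_max_left _ _)) _
    · obtain ⟨i1, i2, i3⟩ := ih k (l + 1) hk (by omega) ⟨rfl, by simpa using h2, h3.2⟩
      refine ⟨i1, by omega, ?_⟩
      have h4 := rotate_succ_succ (m := m) (n := n) x (i := m - k) (j := n - l)
        (by omega) (by omega)
      rw [Nat.sub_sub_self i1, Nat.sub_sub_self (by omega)] at h4
      rw [show n + 1 - (l + 1) = n - l by omega, show m + 1 - k = m - k + 1 by omega] at i3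
      rw [show m + 1 - k = m - k + 1 by omega, show n + 1 - l = n - l + 1 by omega, passage, h4,
        List.map_cons, List.sum_cons, Nat.cast_add, add_comm]
      exact add_le_add_left (i3.trans (le_max_right _ _)) _

theorem exists_path_eq_passage {m n : ℕ} (x : ℕ → ℕ → ℕ) : ∀ i j : ℕ, i < m → j < n →
    ∃ P, IsDirectedPath P (m - i, n - j) (m, n) ∧
      (((P.map fun p => x p.1 p.2).sum : ℕ) : ℤ) = passage (rotate m n x) (i + 1) (j + 1) := by
  have down : ∀ i j, i + 1 < m → j < n →
      passage (rotate m n x) (i + 2) j ≤ passage (rotate m n x) (i + 1) (j + 1) →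
      (∃ P, IsDirectedPath P (m - i, n - j) (m, n) ∧
        (((P.map fun p => x p.1 p.2).sum : ℕ) : ℤ) = passage (rotate m n x) (i + 1) (j + 1)) →
      ∃ P, IsDirectedPath P (m - (i + 1), n - j) (m, n) ∧
        (((P.map fun p => x p.1 p.2).sum : ℕ) : ℤ) =
          passage (rotate m n x) (i + 1 + 1) (j + 1) := by
    rintro i j hi hj hle ⟨P, hP, hsum⟩
    refine ⟨_, isDirectedPath_cons hP (Or.inl (Prod.ext ?_ rfl)), ?_⟩
    · change m - i = m - (i + 1) + 1
      omega
    · rw [List.map_cons, List.sum_cons, Nat.cast_add, hsum,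
        passage_succ_succ _ (i + 1), max_eq_left hle,
        rotate_succ_succ x hi hj, add_comm]
  have right : ∀ i j, i < m → j + 1 < n →
      passage (rotate m n x) i (j + 2) ≤ passage (rotate m n x) (i + 1) (j + 1) →
      (∃ P, IsDirectedPath P (m - i, n - j) (m, n) ∧
        (((P.map fun p => x p.1 p.2).sum : ℕ) : ℤ) = passage (rotate m n x) (i + 1) (j + 1)) →
      ∃ P, IsDirectedPath P (m - i, n - (j + 1)) (m, n) ∧
        (((P.map fun p => x p.1 p.2).sum : ℕ) : ℤ) =
          passage (rotate m n x) (i + 1) (j + 1 + 1) := by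
    rintro i j hi hj hle ⟨P, hP, hsum⟩
    refine ⟨_, isDirectedPath_cons hP (Or.inr (Prod.ext rfl ?_)), ?_⟩
    · change n - j = n - (j + 1) + 1
      omega
    · rw [List.map_cons, List.sum_cons, Nat.cast_add, hsum,
        passage_succ_succ _ _ (j + 1), max_eq_right hle,
        rotate_succ_succ x hi hj, add_comm]
  have hnn := passage_nonneg (rotate_nonneg m n x)
  intro i
  induction i with
  | zero =>
    intro j
    induction j with
    | zero =>
      intro hi hj
      refine ⟨[(m, n)], by simp [IsDirectedPath], ?_⟩
      rw [passage, rotate_succ_succ x hi hj]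
      simp
    | succ j ih =>
      intro hi hj
      -- On the border the missing neighbour has passage time 0, so the maximum is attained by the
      -- other one.
      exact right 0 j hi hj (by simpa using hnn _ _) (ih hi (by omega))
  | succ i ihi =>
    intro j
    induction j with
    | zero =>
      intro hi hj
      exact down i 0 hi hj (by simpa using hnn _ _) (ihi 0 (by omega) hj)
    | succ j ihj =>
      intro hi hj
      rcases le_total (passage (rotate m n x) (i + 2) (j + 1))
        (passage (rotate m n x) (i + 1) (j + 2)) with h | h
      · exact down i (j + 1) hi hj h (ihi (j + 1) (by omega) hj)
      · exact right (i + 1) j hi hj h (ihj hi (by omega))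

theorem lastPassageTime_eq_passage (x : ℕ → ℕ → ℕ) {m n : ℕ} (hm : 1 ≤ m) (hn : 1 ≤ n) :
    (lastPassageTime x m n : ℤ) = passage (rotate m n x) m n := by
  obtain ⟨⟨P, hP, hsum⟩, hmax⟩ := isGreatest_lastPassageTime x hm hn
  obtain ⟨Q, hQ, hsum'⟩ := exists_path_eq_passage x (m - 1) (n - 1)
    (Nat.sub_one_lt_of_lt hm) (Nat.sub_one_lt_of_lt hn)
  rw [Nat.sub_sub_self hm, Nat.sub_sub_self hn] at hQ
  rw [Nat.sub_add_cancel hm, Nat.sub_add_cancel hn] at hsum'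
  refine le_antisymm ?_ ?_
  · rw [hsum]
    simpa using (sum_path_le_passage x P 1 1 one_pos one_pos hP).2.2
  · rw [← hsum']
    exact Nat.cast_le.2 (hmax ⟨Q, hQ, rfl⟩)

theorem rotate_mem_passageSet_iff (x : ℕ → ℕ → ℕ) {m n a : ℕ} (hm : 1 ≤ m) (hn : 1 ≤ n) :
    rotate m n x ∈ passageSet m n a ↔ lastPassageTime x m n ≤ a := by
  have h1 : IsMonoOn n 0 0 (rotate m n x) := by
    refine ⟨fun j => rotate_eq_zero _ (by omega), fun i => rotate_eq_zero _ (by omega),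
      rotate_nonneg m n x, fun i j h => ?_, fun i j h => ?_⟩
    · rw [rotate_eq_zero (i := i) _ (by unfold Stage at h; omega)]
      exact rotate_nonneg _ _ _ _ _
    · rw [rotate_eq_zero (j := j) _ (by unfold Stage at h; omega)]
      exact rotate_nonneg _ _ _ _ _
  have h2 : ∀ i j, m < i ∨ n < j → rotate m n x i j = 0 :=
    fun i j h => rotate_eq_zero _ (by omega)
  rw [← Nat.cast_le (α := ℤ), lastPassageTime_eq_passage x hm hn]
  exact ⟨fun h => h.2.2, fun h => ⟨h1, h2, h⟩⟩

theorem rotate_eq_iff {m n : ℕ} (x : ℕ → ℕ → ℕ) {f : ℕ → ℕ → ℤ} (hf : IsMonoOn n 0 0 f)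
    (hoff : ∀ i j, m < i ∨ n < j → f i j = 0) :
    rotate m n x = f ↔ ∀ p ∈ Finset.range m ×ˢ Finset.range n,
      x (p.1 + 1) (p.2 + 1) = (f (m - p.1) (n - p.2)).toNat := by
  constructor
  · rintro rfl ⟨k, l⟩ hp
    simp only [Finset.mem_product, Finset.mem_range] at hp ⊢
    rw [rotate, if_pos (by omega), Int.toNat_natCast]
    congr <;> omega
  · intro h
    funext i j
    by_cases hij : i = 0 ∨ j = 0 ∨ m < i ∨ n < j
    · rw [rotate_eq_zero _ hij]
      rcases hij with rfl | rfl | hij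
      · rw [hf.left_axis]
      · rw [hf.upper_axis]
      · rw [hoff i j hij]
    · have h1 := h (m - i, n - j) (by simp only [Finset.mem_product, Finset.mem_range]; omega)
      simp only at h1
      rw [Nat.sub_sub_self (by omega), Nat.sub_sub_self (by omega)] at h1
      rw [rotate, if_pos (by omega), show m + 1 - i = m - i + 1 by omega,
        show n + 1 - j = n - j + 1 by omega, h1, Int.toNat_of_nonneg (hf.nonneg i j)]

/-! ### Generating functions and geometric weights. -/

theorem eval_schurPoly_rectDiagram (q : ℕ → ℝ) (m n a : ℕ) :
    MvPolynomial.eval (Fin.append (fun _ : Fin m => (1 : ℝ)) (fun j : Fin n => q (j.val + 1)))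
      (schurPoly ℝ (rectDiagram m a) (m + n)) =
    ∑ T : BoundedSSYT (rectDiagram m a) (m + n), ∏ j ∈ Finset.range n,
      q (n - j) ^ ((rectDiagram m a).cells.filter fun c => T.1 c.1 c.2 + j + 1 = m + n).card := by
  -- Each letter's weight is a product with at most one nontrivial factor, so exchanging products
  -- groups the cells by letter.
  have happ : ∀ k : Fin (m + n),
      Fin.append (fun _ : Fin m => (1 : ℝ)) (fun j : Fin n => q (j.val + 1)) k =
        ∏ j ∈ Finset.range n, if k.val + j + 1 = m + n then q (n - j) else 1 := by
    intro k
    refine Fin.addCases (fun i => ?_) (fun i => ?_) k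
    · rw [Fin.append_left]
      refine (Finset.prod_eq_one fun j hj => if_neg ?_).symm
      rw [Finset.mem_range] at hj
      rw [Fin.val_castAdd]
      omega
    · rw [Fin.append_right, Finset.prod_eq_single (n - 1 - i.val)]
      · rw [Fin.val_natAdd, if_pos (by omega), show n - (n - 1 - i.val) = i.val + 1 by omega]
      · intro j hj hne
        rw [Finset.mem_range] at hj
        rw [Fin.val_natAdd]
        exact if_neg (by omega)
      · intro h
        rw [Finset.mem_range] at h
        omega
  simp only [schurPoly, map_sum, map_prod, MvPolynomial.eval_X, happ]
  refine Finset.sum_congr rfl fun T _ => ?_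
  rw [Finset.prod_coe_sort (rectDiagram m a).cells fun c =>
    ∏ j ∈ Finset.range n, if T.1 c.1 c.2 + j + 1 = m + n then q (n - j) else 1, Finset.prod_comm]
  refine Finset.prod_congr rfl fun j _ => ?_
  rw [Finset.prod_ite, Finset.prod_const, Finset.prod_const_one, mul_one]

theorem finite_passageSet (m n a : ℕ) : (passageSet m n a).Finite := by
  obtain ⟨Φ, hΦ, -⟩ := exists_bijOn_passageSet m n a
  refine Set.Finite.of_finite_image ?_ hΦ.injOn
  rw [hΦ.image_eq, ← (bijOn_rowCount m n a).image_eq]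
  exact Set.toFinite _

/-- The truncated Cauchy identity: the generating function, by column sums, of the arrays with
bounded last-passage time is a Schur polynomial of rectangular shape. -/
theorem sum_passageSet (q : ℕ → ℝ) (m n a : ℕ) :
    ∑ f ∈ (finite_passageSet m n a).toFinset, ∏ j ∈ Finset.range n,
      q (n - j) ^ (boxSum f m (j + 1) - boxSum f m j).toNat =
    MvPolynomial.eval (Fin.append (fun _ : Fin m => (1 : ℝ)) (fun j : Fin n => q (j.val + 1)))
      (schurPoly ℝ (rectDiagram m a) (m + n)) := by
  obtain ⟨Φ, hΦ, hd⟩ := exists_bijOn_passageSet m n a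
  rw [eval_schurPoly_rectDiagram, ← finsum_mem_eq_finite_toFinset_sum,
    finsum_mem_eq_of_bijOn (g := fun g => ∏ j ∈ Finset.range n,
      q (n - j) ^ (diagSum g m (j + 1) - diagSum g m j).toNat) Φ hΦ,
    ← finsum_mem_eq_of_bijOn _ (bijOn_rowCount m n a) (fun _ _ => rfl), finsum_mem_univ,
    finsum_eq_sum_of_fintype]
  · refine Finset.sum_congr rfl fun T _ => Finset.prod_congr rfl fun j hj => ?_
    rw [diagSum_rowCount_sub T (Finset.mem_range.1 hj), Int.toNat_natCast]
  · intro f hf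
    refine Finset.prod_congr rfl fun j hj => ?_
    rw [Finset.mem_range] at hj
    rw [hd f hf (j + 1) hj, hd f hf j hj.le]

theorem boxSum_succ_sub (f : ℕ → ℕ → ℤ) (m j : ℕ) :
    boxSum f m (j + 1) - boxSum f m j = ∑ k ∈ Finset.range m, f (k + 1) (j + 1) := by
  simp [boxSum, Finset.sum_range_succ, Finset.sum_add_distrib]

/-- Column `n - j` of the random array is column `j + 1` of `f`, whence the reflected index of `q`.
-/
theorem prod_geometric_weights (q : ℕ → ℝ) (m n : ℕ) {f : ℕ → ℕ → ℤ} (hf : ∀ i j, 0 ≤ f i j) :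
    ∏ p ∈ Finset.range m ×ˢ Finset.range n,
      (1 - q (p.2 + 1)) * q (p.2 + 1) ^ (f (m - p.1) (n - p.2)).toNat =
    (∏ j ∈ Finset.Icc 1 n, (1 - q j) ^ m) * ∏ j ∈ Finset.range n,
      q (n - j) ^ (boxSum f m (j + 1) - boxSum f m j).toNat := by
  rw [Finset.prod_mul_distrib]
  congr 1
  · rw [Finset.prod_product_right, ← Finset.Ico_add_one_right_eq_Icc, Finset.prod_Ico_eq_prod_range]
    simp [add_comm]
  · rw [Finset.prod_product_right, ← Finset.prod_range_reflect]
    refine Finset.prod_congr rfl fun j hj => ?_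
    rw [Finset.mem_range] at hj
    dsimp only
    rw [Finset.prod_pow_eq_pow_sum, show n - 1 - j + 1 = n - j by omega,
      show n - (n - 1 - j) = j + 1 by omega, boxSum_succ_sub, ← Finset.sum_range_reflect]
    congr 1
    zify
    rw [Int.toNat_of_nonneg (Finset.sum_nonneg fun k _ => hf _ _)]
    refine Finset.sum_congr rfl fun k hk => ?_
    rw [Finset.mem_range] at hk
    rw [Int.toNat_of_nonneg (hf _ _), show m - (m - 1 - k) = k + 1 by omega]

end SchurLPP

/-! ### Summation of the probability over arrays. -/

theorem mainTheorem4 {Ω : Type*} [MeasurableSpace Ω]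
    (μ : MeasureTheory.Measure Ω) [MeasureTheory.IsProbabilityMeasure μ]
    (q : ℕ → ℝ) (hq : ∀ j, 1 ≤ j → 0 < q j ∧ q j < 1)
    (w : ℕ → ℕ → Ω → ℕ) (hw : ∀ i j, 1 ≤ i → 1 ≤ j → Measurable (w i j))
    (hindep : ProbabilityTheory.iIndepFun (fun p : ℕ × ℕ => w (p.1 + 1) (p.2 + 1)) μ)
    (hgeom : ∀ i j, 1 ≤ i → 1 ≤ j → ∀ k : ℕ,
      μ.real {ω | w i j ω = k} = (1 - q j) * q j ^ k)
    (m n : ℕ) (hm : 1 ≤ m) (hn : 1 ≤ n) (a : ℕ) :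
    μ.real {ω | SchurLPP.lastPassageTime (fun i j => w i j ω) m n ≤ a} =
      (∏ j ∈ Finset.Icc 1 n, (1 - q j) ^ m) *
        MvPolynomial.eval
          (Fin.append (fun _ : Fin m => (1 : ℝ)) (fun j : Fin n => q (j.val + 1)))
          (SchurLPP.schurPoly ℝ (SchurLPP.rectDiagram m a) (m + n)) := by
  let R : Ω → ℕ → ℕ → ℤ := fun ω => SchurLPP.rotate m n fun i j => w i j ω
  let S := (SchurLPP.finite_passageSet m n a).toFinset
  have hS : ∀ f ∈ S, f ∈ SchurLPP.passageSet m n a := fun f hf => by simpa [S] using hf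
  have hevent : {ω | SchurLPP.lastPassageTime (fun i j => w i j ω) m n ≤ a} = R ⁻¹' S := by
    ext ω
    simp only [S, Set.Finite.coe_toFinset, Set.mem_preimage]
    exact (SchurLPP.rotate_mem_passageSet_iff _ hm hn).symm
  -- The fibre over one array prescribes finitely many independent variables, so its probability is
  -- a product.
  have hR : ∀ f ∈ S, R ⁻¹' {f} = ⋂ p ∈ Finset.range m ×ˢ Finset.range n,
      w (p.1 + 1) (p.2 + 1) ⁻¹' {(f (m - p.1) (n - p.2)).toNat} := fun f hf => by
    ext ω
    simp only [Set.mem_iInter, Set.mem_preimage, Set.mem_singleton_iff]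
    exact SchurLPP.rotate_eq_iff _ (hS f hf).1 (hS f hf).2.1
  rw [hevent, ← MeasureTheory.sum_measureReal_preimage_singleton, ← SchurLPP.sum_passageSet,
    Finset.mul_sum]
  · refine Finset.sum_congr rfl fun f hf => ?_
    rw [hR f hf, ← SchurLPP.prod_geometric_weights q m n (hS f hf).1.nonneg,
      MeasureTheory.measureReal_def, hindep.measure_inter_preimage_eq_mul
        (sets := fun p => {(f (m - p.1) (n - p.2)).toNat})
        _ (fun p _ => MeasurableSet.singleton _), ENNReal.toReal_prod]
    exact Finset.prod_congr rfl fun p _ =>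
      hgeom (p.1 + 1) (p.2 + 1) (Nat.le_add_left 1 _) (Nat.le_add_left 1 _) _
  · intro f hf
    rw [hR f hf]
    exact Finset.measurableSet_biInter _ fun p _ =>
      hw _ _ (Nat.le_add_left 1 _) (Nat.le_add_left 1 _) (MeasurableSet.singleton _)
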